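/- Let $R$ be a nonzero commutative ring and let $\mathcal A$ be a finite, central and essential arrangement of linear hyperplanes in $W=\mathbb R^\ell$ (so $\bigcap_{H\in\mathcal A}H=0$), with a linear form $f_H$ with kernel $H$ fixed for each $H\in\mathcal A$. Let $L(\mathcal A)$ be the set of intersections of subsets of $\mathcal A$ (including $W$, the empty intersection), ordered by reverse inclusion, with Möbius function $\mu$; let $L_p(\mathcal A)$ be its elements of codimension $p$, and put $b_p=(-1)^p\sum_{X\in L_p(\mathcal A)}\mu(W,X)$. For $X\in L(\mathcal A)$ let $\mathcal A_X=\{H\in\mathcal A: X\subseteq H\}$, an arrangement in $W$ with the same forms $f_H$. For any finite arrangement $\mathcal B$ of linear hyperplanes in $W$ with chosen forms, a chamber of $\mathcal B$ is a connected component of $W\setminus\bigcup_{H\in\mathcal B}H$. Let $V=V(\mathcal B)$ be the free $R$-module on the chambers and $V^*=\operatorname{Hom}_R(V,R)$, identified with the ring of $R$-valued functions on chambers under pointwise multiplication. For $H\in\mathcal B$ let $x_H\in V^*$ be the function that is $1$ on the chambers where $f_H>0$ and $0$ on the others. For $p\ge 0$ let $P_pV^*$ be the set of elements of $V^*$ that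 can be written as polynomials over $R$ of degree at most $p$ in the $x_H$, let $P_{-1}V^*=0$, and put $\operatorname{gr}_pV^*=P_pV^*/P_{p-1}V^*$. Let $W^pV=\{v\in V: f(v)=0\text{ for all }f\in P_{p-1}V^*\}$ and $\operatorname{gr}^pV=W^pV/W^{p+1}V$. For $X\in L(\mathcal A)$, the map that sends each chamber of $\mathcal A$ to the chamber of $\mathcal A_X$ containing it extends linearly to $V(\mathcal A)\to V(\mathcal A_X)$; this preserves the filtrations $W^\bullet$ and so induces $\operatorname{gr}^pV(\mathcal A)\to\operatorname{gr}^pV(\mathcal A_X)$. **Proposition.** For every $0\le p\le\ell$, with $V=V(\mathcal A)$: 1. The evaluation pairing $(f,v)\mapsto f(v)$ on $P_pV^*\times W^pV$ induces an isomorphism of $R$-modules $\operatorname{gr}_pV^*\cong(\operatorname{gr}^pV)^*$. 2. $\operatorname{gr}^pV$ is a free $R$-module of finite rank $b_p$. 3. The maps $\operatorname{gr}^pV(\mathcal A)\to\operatorname{gr}^pV(\mathcal A_X)$ above are the components of an isomorphism of $R$-modules $$\operatorname{gr}^pV(\mathcal A)\;\cong\;\bigoplus_{X\in L_p(\mathcal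 A)}\operatorname{gr}^pV(\mathcal A_X).$$ -/

import Mathlib

set_option maxSynthPendingDepth 3

noncomputable section

/-- The ambient real vector space. -/
abbrev Ambient (l : ℕ) : Type := EuclideanSpace ℝ (Fin l)

/-- A finite arrangement of linear hyperplanes in `ℝ^l`, with a choice of a linear equation for
each hyperplane (the choice fixes which side of the hyperplane is the positive one). -/
structure HypArrangement (l : ℕ) where
  hyperplanes : Finset (Submodule ℝ (Ambient l))
  isCoatom : ∀ H ∈ hyperplanes, IsCoatom H
  form : {H // H ∈ hyperplanes} → Module.Dual ℝ (Ambient l)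
  ker_form : ∀ H, LinearMap.ker (form H) = H.1

namespace HypArrangement

variable {l : ℕ}

/-- The hyperplanes of the arrangement meet in the origin only. -/
def IsEssential (A : HypArrangement l) : Prop :=
  A.hyperplanes.inf id = ⊥

/-- The complement of the arrangement. -/
abbrev Complement (A : HypArrangement l) : Type :=
  {x : Ambient l // ∀ H ∈ A.hyperplanes, x ∉ H}

/-- The chambers: connected components of the complement. -/
abbrev Chamber (A : HypArrangement l) : Type :=
  ConnectedComponents A.Complement

/-- The chamber `C` lies on the positive side of the hyperplane `H`. -/
def OnPositiveSide (A : HypArrangement l) (H : {H // H ∈ A.hyperplanes}) (C : A.Chamber) : Prop :=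
  ∀ x : A.Complement, (ConnectedComponents.mk x : A.Chamber) = C → 0 < A.form H x.1

/-- The subarrangement on a subset of the hyperplanes, with the same equations. -/
def sub (A : HypArrangement l) (S : Finset (Submodule ℝ (Ambient l)))
    (hS : S ⊆ A.hyperplanes) : HypArrangement l where
  hyperplanes := S
  isCoatom H hH := A.isCoatom H (hS hH)
  form H := A.form ⟨H.1, hS H.2⟩
  ker_form H := A.ker_form ⟨H.1, hS H.2⟩

/-- `X` lies in the intersection lattice: it is an intersection of some (possibly no)
hyperplanes of the arrangement. -/
def IsFlat (A : HypArrangement l) (X : Submodule ℝ (Ambient l)) : Prop :=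
  ∃ S : Finset (Submodule ℝ (Ambient l)), S ⊆ A.hyperplanes ∧ X = S.inf id

/-- The intersection lattice `L(A)`, ordered by reverse inclusion. -/
abbrev Lattice (A : HypArrangement l) : Type :=
  {X : (Submodule ℝ (Ambient l))ᵒᵈ // A.IsFlat (OrderDual.ofDual X)}

/-- The underlying subspace of an element of `L(A)`. -/
abbrev Lattice.space {A : HypArrangement l} (X : A.Lattice) : Submodule ℝ (Ambient l) :=
  OrderDual.ofDual X.1

theorem finite_lattice (A : HypArrangement l) : Finite A.Lattice := by
  classical
  have h : {X : (Submodule ℝ (Ambient l))ᵒᵈ | A.IsFlat (OrderDual.ofDual X)}.Finite := by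
    refine (A.hyperplanes.powerset.image
      (fun S => OrderDual.toDual (S.inf id))).finite_toSet.subset ?_
    rintro X ⟨S, hS, hX⟩
    simp only [Finset.coe_image, Set.mem_image, Finset.mem_coe, Finset.mem_powerset]
    exact ⟨S, hS, by rw [← hX]; rfl⟩
  exact h

instance (A : HypArrangement l) : Fintype A.Lattice :=
  letI := A.finite_lattice
  Fintype.ofFinite _

instance (A : HypArrangement l) : DecidableEq A.Lattice := Classical.decEq _

instance (A : HypArrangement l) : LocallyFiniteOrder A.Lattice :=
  letI := Classical.decRel ((· ≤ ·) : A.Lattice → A.Lattice → Prop)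
  letI := Classical.decRel ((· < ·) : A.Lattice → A.Lattice → Prop)
  Fintype.toLocallyFiniteOrder

/-- The whole space, as the least element of `L(A)`. -/
def Lattice.whole (A : HypArrangement l) : A.Lattice :=
  ⟨OrderDual.toDual ⊤, ∅, by simp, by simp⟩

/-- `L_p(A)`: the elements of `L(A)` of codimension `p`. -/
abbrev LatticeCodim (A : HypArrangement l) (p : ℕ) : Type :=
  {X : A.Lattice // Module.finrank ℝ X.space + p = l}

instance (A : HypArrangement l) (p : ℕ) : DecidableEq (A.LatticeCodim p) := Classical.decEq _

instance (A : HypArrangement l) (p : ℕ) : Fintype (A.LatticeCodim p) := by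
  classical exact Subtype.fintype _

/-- The Betti number `b_p = (-1)^p ∑_{X ∈ L_p} μ(W, X)`, with `μ` the Möbius function of `L(A)`. -/
def betti (A : HypArrangement l) (p : ℕ) : ℤ :=
  (-1) ^ p * ∑ X : A.LatticeCodim p, IncidenceAlgebra.mu ℤ (Lattice.whole A) X.1

open Classical in
/-- `A_X`, the arrangement of the hyperplanes of `A` that contain `X`. -/
def localization (A : HypArrangement l) (X : Submodule ℝ (Ambient l)) : HypArrangement l :=
  A.sub (A.hyperplanes.filter (fun H => X ≤ H)) (Finset.filter_subset _ _)

section Coefficients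

variable (R : Type*) [CommRing R]

/-- `V(A)`: the free module on the chambers. -/
abbrev V (A : HypArrangement l) : Type _ := A.Chamber →₀ R

open Classical in
/-- The Heaviside function `x_H`, as a function on chambers. -/
def heaviside (A : HypArrangement l) (H : {H // H ∈ A.hyperplanes}) : A.Chamber → R :=
  fun C => if A.OnPositiveSide H C then 1 else 0

/-- The functional on `V(A)` given by evaluating a polynomial in the Heaviside functions
`x_H`, where functions on chambers are multiplied coordinatewise and are identified with
functionals on `V(A)`. -/
def polyFunctional (A : HypArrangement l) :
    MvPolynomial {H // H ∈ A.hyperplanes} R →ₗ[R] Module.Dual R (A.V R) :=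
  (Finsupp.llift R R R A.Chamber).toLinearMap ∘ₗ
    (MvPolynomial.aeval (R := R) (A.heaviside R)).toLinearMap

/-- The degree filtration `P_p V*`: functionals that can be written as polynomials of degree at
most `p` in the Heaviside functions. -/
def degFil (A : HypArrangement l) (p : ℕ) : Submodule R (Module.Dual R (A.V R)) :=
  (MvPolynomial.restrictTotalDegree {H // H ∈ A.hyperplanes} R p).map (A.polyFunctional R)

/-- `P_{p-1} V*`, where `P_{-1} V* = 0`. -/
def degFilPred (A : HypArrangement l) : ℕ → Submodule R (Module.Dual R (A.V R))
  | 0 => ⊥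
  | p + 1 => A.degFil R p

/-- The dual filtration `W^p V`: the vectors on which all of `P_{p-1} V*` vanishes. -/
def dualFil (A : HypArrangement l) (p : ℕ) : Submodule R (A.V R) :=
  (A.degFilPred R p).dualCoannihilator

/-- `gr_p V* = P_p V* / P_{p-1} V*`. -/
abbrev GrDeg (A : HypArrangement l) (p : ℕ) : Type _ :=
  A.degFil R p ⧸ (A.degFilPred R p).submoduleOf (A.degFil R p)

/-- `gr^p V = W^p V / W^{p+1} V`. -/
abbrev GrDual (A : HypArrangement l) (p : ℕ) : Type _ :=
  A.dualFil R p ⧸ (A.dualFil R (p + 1)).submoduleOf (A.dualFil R p)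

/-- The inclusion of the complement of `A` into the complement of a subarrangement. -/
def complementIncl (A : HypArrangement l) (S : Finset (Submodule ℝ (Ambient l)))
    (hS : S ⊆ A.hyperplanes) (x : A.Complement) : (A.sub S hS).Complement :=
  ⟨x.1, fun H hH => x.2 H (hS hH)⟩

theorem continuous_complementIncl (A : HypArrangement l) (S : Finset (Submodule ℝ (Ambient l)))
    (hS : S ⊆ A.hyperplanes) : Continuous (A.complementIncl S hS) :=
  Continuous.subtype_mk continuous_subtype_val _

/-- The map of chambers `C(A) → C(B)` for a subarrangement `B`: a chamber goes to the chamber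
that contains it. -/
def chamberMap (A : HypArrangement l) (S : Finset (Submodule ℝ (Ambient l)))
    (hS : S ⊆ A.hyperplanes) : A.Chamber → (A.sub S hS).Chamber :=
  (A.continuous_complementIncl S hS).connectedComponentsMap

/-- The natural map `V(A) → V(B)`, the linear extension of the map of chambers. -/
def natMap (A : HypArrangement l) (S : Finset (Submodule ℝ (Ambient l)))
    (hS : S ⊆ A.hyperplanes) : A.V R →ₗ[R] (A.sub S hS).V R :=
  Finsupp.lmapDomain R R (A.chamberMap S hS)

theorem pos_of_mk_eq (A : HypArrangement l) (H : {H // H ∈ A.hyperplanes}) {x y : A.Complement}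
    (h : (ConnectedComponents.mk x : A.Chamber) = ConnectedComponents.mk y)
    (hx : 0 < A.form H x.1) : 0 < A.form H y.1 := by
  have hc : Continuous (fun z : A.Complement => A.form H z.1) :=
    (LinearMap.continuous_of_finiteDimensional (A.form H)).comp continuous_subtype_val
  have hne : ∀ z : A.Complement, A.form H z.1 ≠ 0 := by
    intro z hz
    refine z.2 H.1 H.2 ?_
    rw [← A.ker_form H]
    exact hz
  have hclopen : IsClopen {z : A.Complement | 0 < A.form H z.1} := by
    refine ⟨?_, isOpen_lt continuous_const hc⟩
    have : {z : A.Complement | 0 < A.form H z.1} = {z | 0 ≤ A.form H z.1} := by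
      ext z
      exact ⟨fun h => le_of_lt (show 0 < A.form H z.1 from h),
      fun h => lt_of_le_of_ne h (hne z).symm⟩
    rw [this]
    exact isClosed_le continuous_const hc
  have hsub := hclopen.connectedComponent_subset (x := x) hx
  rw [ConnectedComponents.coe_eq_coe] at h
  exact hsub (h ▸ mem_connectedComponent)

theorem onPositiveSide_mk (A : HypArrangement l) (H : {H // H ∈ A.hyperplanes})
    (x : A.Complement) :
    A.OnPositiveSide H (ConnectedComponents.mk x) ↔ 0 < A.form H x.1 :=
  ⟨fun h => h x rfl, fun h _ hy => A.pos_of_mk_eq H hy.symm h⟩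

theorem heaviside_chamberMap (A : HypArrangement l) (S : Finset (Submodule ℝ (Ambient l)))
    (hS : S ⊆ A.hyperplanes) (H : {H // H ∈ (A.sub S hS).hyperplanes}) (C : A.Chamber) :
    (A.sub S hS).heaviside R H (A.chamberMap S hS C) = A.heaviside R ⟨H.1, hS H.2⟩ C := by
  obtain ⟨x, rfl⟩ := ConnectedComponents.surjective_coe C
  have h : (A.sub S hS).OnPositiveSide H (A.chamberMap S hS (ConnectedComponents.mk x)) ↔
      A.OnPositiveSide ⟨H.1, hS H.2⟩ (ConnectedComponents.mk x) := by
    rw [onPositiveSide_mk]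
    exact onPositiveSide_mk (A.sub S hS) H (A.complementIncl S hS x)
  classical exact if_congr h rfl rfl

theorem comp_natMap_mem_degFil (A : HypArrangement l) (S : Finset (Submodule ℝ (Ambient l)))
    (hS : S ⊆ A.hyperplanes) (p : ℕ) {f : Module.Dual R ((A.sub S hS).V R)}
    (hf : f ∈ (A.sub S hS).degFil R p) : f ∘ₗ A.natMap R S hS ∈ A.degFil R p := by
  obtain ⟨q, hq, rfl⟩ := hf
  let j : {H // H ∈ (A.sub S hS).hyperplanes} → {H // H ∈ A.hyperplanes} := fun H => ⟨H.1, hS H.2⟩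
  refine ⟨MvPolynomial.rename j q, ?_, ?_⟩
  · have hq' := (MvPolynomial.mem_restrictTotalDegree _ _ _).1 hq
    exact (MvPolynomial.mem_restrictTotalDegree _ _ _).2
      ((MvPolynomial.totalDegree_rename_le j q).trans hq')
  · ext C
    have key : ∀ q : MvPolynomial {H // H ∈ (A.sub S hS).hyperplanes} R,
        MvPolynomial.aeval (R := R) (A.heaviside R) (MvPolynomial.rename j q) C =
        MvPolynomial.aeval (R := R) ((A.sub S hS).heaviside R) q (A.chamberMap S hS C) := by
      intro q
      induction q using MvPolynomial.induction_on with
      | C a => simp [MvPolynomial.algebraMap_eq]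
      | add a b ha hb => simp only [map_add, Pi.add_apply, ha, hb]
      | mul_X a H ha =>
        rw [map_mul, map_mul, map_mul, Pi.mul_apply, Pi.mul_apply, ha, MvPolynomial.rename_X,
          MvPolynomial.aeval_X, MvPolynomial.aeval_X]
        congr 1
        exact (A.heaviside_chamberMap R S hS H C).symm
    simpa [polyFunctional, natMap] using key q

theorem natMap_mem_dualFil (A : HypArrangement l) (S : Finset (Submodule ℝ (Ambient l)))
    (hS : S ⊆ A.hyperplanes) (p : ℕ) :
    ∀ v ∈ A.dualFil R p, A.natMap R S hS v ∈ (A.sub S hS).dualFil R p := by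
  intro v hv
  rw [dualFil, Submodule.mem_dualCoannihilator] at hv ⊢
  intro f hf
  cases p with
  | zero =>
    have : f = 0 := hf
    simp [this]
  | succ p => exact hv _ (A.comp_natMap_mem_degFil R S hS p hf)

/-- The map `gr^p V(A) → gr^p V(B)` induced by the natural map `V(A) → V(B)`. -/
def grMap (A : HypArrangement l) (S : Finset (Submodule ℝ (Ambient l)))
    (hS : S ⊆ A.hyperplanes) (p : ℕ) : A.GrDual R p →ₗ[R] (A.sub S hS).GrDual R p :=
  Submodule.mapQ _ _
    ((A.natMap R S hS).restrict (A.natMap_mem_dualFil R S hS p))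
    (fun v hv => A.natMap_mem_dualFil R S hS (p + 1) v.1 hv)

open Classical in
/-- The map `gr^p V(A) → gr^p V(A_X)` induced by the natural map `V(A) → V(A_X)`. -/
def grLocalization (A : HypArrangement l) (X : Submodule ℝ (Ambient l)) (p : ℕ) :
    A.GrDual R p →ₗ[R] (A.localization X).GrDual R p :=
  A.grMap R (A.hyperplanes.filter (fun H => X ≤ H)) (Finset.filter_subset _ _) p

end Coefficients

end HypArrangement

end

/-! Fix an injective ranking `ρ` of the hyperplanes. No-broken-circuit (NBC) sets of size `p` index
dual bases of both graded pieces, and the three claims follow by reading everything in these bases.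

Spanning (`mono_mem_span_nbc`, `degFil_eq_span`): the Heaviside functions are idempotent, so
squarefree monomials suffice. A linear dependence among equations excludes two sign patterns on
chambers. The two resulting product identities rewrite a monomial containing a broken circuit by
monomials of no larger degree and smaller weight.

Duality (`exists_dual_vector`): an NBC set `S` determines a flag. Near it, sign flips indexed by
subsets of the `|S|` pivots of `S` give points of the complement. Their alternating sum lies in
`W^|S| V`, takes value 1 on the monomial of `S`, and kills those of the other NBC sets of the same
size. So the degree `p` NBC monomials are coordinates on `gr^p V` (`nbcEquiv`), and the pairing is
perfect.

Rank and decomposition: `p`-element NBC sets have intersections of codimension `p`. Counted with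
sign by intersection, they give the Möbius function (`mu_whole_eq_sum`). Those with intersection `X`
are exactly the `p`-element NBC sets of `A_X`, so the coordinates split over flats. -/

namespace HypArrangement

open scoped Classical

/-! ### No-broken-circuit sets and the Möbius function -/

section NoBrokenCircuit

variable {l : ℕ} (A : HypArrangement l) (ρ : Submodule ℝ (Ambient l) → ℕ)

/-- `T` contains no broken circuit for the order on the hyperplanes given by `ρ`: no hyperplane
of the arrangement depends on the strictly larger elements of `T`. -/
def IsNBC (T : Finset (Submodule ℝ (Ambient l))) : Prop :=
  T ⊆ A.hyperplanes ∧
    ∀ H ∈ A.hyperplanes, ¬ (T.filter (fun K => ρ H < ρ K)).inf id ≤ H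

variable {A ρ}

theorem IsNBC.mono {S T : Finset (Submodule ℝ (Ambient l))} (hT : A.IsNBC ρ T) (h : S ⊆ T) :
    A.IsNBC ρ S :=
  ⟨h.trans hT.1, fun H hH hle =>
    hT.2 H hH ((Finset.inf_mono (Finset.filter_subset_filter _ h)).trans hle)⟩

variable (A) in
theorem finrank_add_one_of_mem {H : Submodule ℝ (Ambient l)} (hH : H ∈ A.hyperplanes) :
    Module.finrank ℝ H + 1 = l := by
  have hne : A.form ⟨H, hH⟩ ≠ 0 := by
    intro h
    have := A.ker_form ⟨H, hH⟩
    rw [h, LinearMap.ker_zero] at this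
    exact (A.isCoatom H hH).1 this.symm
  have := Module.Dual.finrank_ker_add_one_of_ne_zero hne
  rw [A.ker_form ⟨H, hH⟩] at this
  simpa using this

/-- NBC sets are independent: the lowest-ranked element does not contain the intersection of the
others, so adding it lowers the dimension by exactly one. -/
theorem IsNBC.finrank_inf_add_card (hρ : Set.InjOn ρ A.hyperplanes)
    {T : Finset (Submodule ℝ (Ambient l))} (hT : A.IsNBC ρ T) :
    Module.finrank ℝ (T.inf id : Submodule ℝ (Ambient l)) + T.card = l := by
  induction T using Finset.induction_on_min_value ρ with
  | empty => rw [Finset.inf_empty, finrank_top]; simp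
  | insert a s ha hmin ih =>
    have ih := ih (hT.mono (Finset.subset_insert a s))
    have haA : a ∈ A.hyperplanes := hT.1 (Finset.mem_insert_self a s)
    have hnot : ¬ s.inf id ≤ a := by
      intro hle
      refine hT.2 a haA (le_trans (Finset.inf_mono ?_) hle)
      intro K hK
      refine Finset.mem_filter.2 ⟨Finset.mem_insert_of_mem hK, lt_of_le_of_ne (hmin K hK) ?_⟩
      intro h
      exact ha (hρ haA (hT.1 (Finset.mem_insert_of_mem hK)) h ▸ hK)
    have htop : a ⊔ s.inf id = ⊤ := by
      refine (A.isCoatom a haA).2 _ (lt_of_le_of_ne le_sup_left ?_)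
      intro h
      exact hnot (h ▸ le_sup_right)
    have h1 := Submodule.finrank_sup_add_finrank_inf_eq a (s.inf id)
    rw [htop, finrank_top, finrank_euclideanSpace_fin] at h1
    have h2 := A.finrank_add_one_of_mem haA
    rw [Finset.inf_insert, Finset.card_insert_of_notMem ha]
    simp only [id] at *
    omega

variable (A) in
theorem mem_localization_hyperplanes {X H : Submodule ℝ (Ambient l)} :
    H ∈ (A.localization X).hyperplanes ↔ H ∈ A.hyperplanes ∧ X ≤ H := by
  simp [localization, sub]

/-- A hyperplane violating the condition for a set whose intersection contains `X` itself contains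
`X`, so passing to `A_X` loses no violations. -/
theorem isNBC_localization_iff {X : Submodule ℝ (Ambient l)}
    {T : Finset (Submodule ℝ (Ambient l))} :
    (A.localization X).IsNBC ρ T ↔ A.IsNBC ρ T ∧ X ≤ T.inf id := by
  constructor
  · intro h
    have hX : X ≤ T.inf id :=
      Finset.le_inf fun H hH => ((A.mem_localization_hyperplanes).1 (h.1 hH)).2
    refine ⟨⟨fun H hH => ((A.mem_localization_hyperplanes).1 (h.1 hH)).1, ?_⟩, hX⟩
    intro H hH hle
    refine h.2 H ((A.mem_localization_hyperplanes).2 ⟨hH, ?_⟩) hle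
    exact (hX.trans (Finset.inf_mono (Finset.filter_subset _ _))).trans hle
  · rintro ⟨h, hX⟩
    refine ⟨fun H hH => (A.mem_localization_hyperplanes).2 ⟨h.1 hH, ?_⟩, fun H hH =>
      h.2 H ((A.mem_localization_hyperplanes).1 hH).1⟩
    exact hX.trans (Finset.inf_le (f := id) hH)

variable (A ρ) in
/-- The no-broken-circuit sets. -/
noncomputable def nbcSets : Finset (Finset (Submodule ℝ (Ambient l))) :=
  A.hyperplanes.powerset.filter (A.IsNBC ρ)

theorem mem_nbcSets {T : Finset (Submodule ℝ (Ambient l))} : T ∈ A.nbcSets ρ ↔ A.IsNBC ρ T := by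
  simp only [nbcSets, Finset.mem_filter, Finset.mem_powerset, and_iff_right_iff_imp]
  exact fun h => h.1

/-- A violating `K` would contain `X`, so `H` is not ranked above `K` and plays no part in the
violation. -/
theorem IsNBC.insert_of_min {X H : Submodule ℝ (Ambient l)} (hH : H ∈ A.hyperplanes)
    (hXH : X ≤ H) (hmin : ∀ K ∈ A.hyperplanes, X ≤ K → ρ H ≤ ρ K)
    {T : Finset (Submodule ℝ (Ambient l))} (hT : A.IsNBC ρ T) (hX : X ≤ T.inf id) :
    A.IsNBC ρ (insert H T) := by
  refine ⟨Finset.insert_subset hH hT.1, fun K hK hle => ?_⟩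
  have hXK : X ≤ K := by
    refine le_trans (le_trans ?_ (Finset.inf_mono (Finset.filter_subset _ _))) hle
    rw [Finset.inf_insert]
    exact le_inf hXH hX
  rw [Finset.filter_insert, if_neg (not_lt.2 (hmin K hK hXK))] at hle
  exact hT.2 K hK hle

/-- The signed count of the no-broken-circuit sets of a nontrivial localization vanishes. -/
theorem sum_nbcSets_neg_one_pow_eq_zero {X H₁ : Submodule ℝ (Ambient l)}
    (hH₁ : H₁ ∈ A.hyperplanes) (hX : X ≤ H₁) :
    ∑ T ∈ (A.nbcSets ρ).filter (fun T => X ≤ T.inf id), (-1 : ℤ) ^ T.card = 0 := by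
  obtain ⟨H, hH, hmin⟩ := Finset.exists_min_image (A.hyperplanes.filter (fun H => X ≤ H)) ρ
    ⟨H₁, Finset.mem_filter.2 ⟨hH₁, hX⟩⟩
  obtain ⟨hHA, hXH⟩ := Finset.mem_filter.1 hH
  have hmin' : ∀ K ∈ A.hyperplanes, X ≤ K → ρ H ≤ ρ K := fun K hK hXK =>
    hmin K (Finset.mem_filter.2 ⟨hK, hXK⟩)
  -- Toggling the lowest-ranked hyperplane containing `X` is a sign-reversing involution.
  refine Finset.sum_involution (fun T _ => if H ∈ T then T.erase H else insert H T) ?_ ?_ ?_ ?_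
  · intro T _
    by_cases h : H ∈ T
    · simp only [h, if_true]
      rw [← Finset.card_erase_add_one h, pow_succ]
      ring
    · simp only [h, if_false]
      rw [Finset.card_insert_of_notMem h, pow_succ]
      ring
  · intro T _ _
    by_cases h : H ∈ T
    · simp only [h, if_true]
      exact fun h' => Finset.notMem_erase H T (h'.symm ▸ h)
    · simp only [h, if_false]
      exact fun h' => h (h' ▸ Finset.mem_insert_self H T)
  · intro T hT
    obtain ⟨hT, hXT⟩ := Finset.mem_filter.1 hT
    rw [mem_nbcSets] at hT
    by_cases h : H ∈ T
    · simp only [h, if_true, Finset.mem_filter, mem_nbcSets]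
      exact ⟨hT.mono (Finset.erase_subset _ _),
        hXT.trans (Finset.inf_mono (Finset.erase_subset _ _))⟩
    · simp only [h, if_false, Finset.mem_filter, mem_nbcSets]
      refine ⟨hT.insert_of_min hHA hXH hmin' hXT, ?_⟩
      rw [Finset.inf_insert]
      exact le_inf hXH hXT
  · intro T _
    by_cases h : H ∈ T
    · simp [h]
    · simp [h]

theorem IsNBC.eq_empty_of_inf_eq_top {T : Finset (Submodule ℝ (Ambient l))} (hT : A.IsNBC ρ T)
    (h : T.inf id = ⊤) : T = ∅ := by
  refine Finset.eq_empty_of_forall_notMem fun H hH => (A.isCoatom H (hT.1 hH)).1 ?_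
  exact top_le_iff.1 (h ▸ Finset.inf_le (f := id) hH)

theorem isNBC_empty : A.IsNBC ρ ∅ :=
  ⟨Finset.empty_subset _, fun H hH h => (A.isCoatom H hH).1 (top_le_iff.1 (by simpa using h))⟩

/-- Both sides are 1 at the whole space and have zero sum over `Y ≤ X` for any other `X`; this
recursion determines them. -/
theorem mu_whole_eq_sum (X : A.Lattice) :
    IncidenceAlgebra.mu ℤ (Lattice.whole A) X =
      ∑ T ∈ (A.nbcSets ρ).filter (fun T => T.inf id = X.space), (-1 : ℤ) ^ T.card := by
  induction X using WellFoundedLT.induction with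
  | ind X ih =>
  by_cases hX : Lattice.whole A = X
  · subst hX
    have : (A.nbcSets ρ).filter (fun T => T.inf id = (Lattice.whole A).space) = {∅} := by
      ext T
      simp only [Finset.mem_filter, mem_nbcSets, Finset.mem_singleton]
      constructor
      · rintro ⟨hT, h⟩
        exact hT.eq_empty_of_inf_eq_top h
      · rintro rfl
        exact ⟨isNBC_empty, rfl⟩
    rw [this]
    simp
  · obtain ⟨S, hS, hXS⟩ := X.2
    have hne : S.Nonempty := by
      rw [Finset.nonempty_iff_ne_empty]
      rintro rfl
      exact hX (Subtype.ext (congrArg OrderDual.toDual hXS).symm)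
    obtain ⟨H, hH⟩ := hne
    have hXH : X.space ≤ H := hXS.le.trans (Finset.inf_le (f := id) hH)
    have key := sum_nbcSets_neg_one_pow_eq_zero (ρ := ρ) (hS hH) hXH
    -- Group the NBC sets by their intersection. The value `Lattice.whole A` is a default, never
    -- reached on NBC sets.
    have hfib := Finset.sum_fiberwise_of_maps_to
      (s := (A.nbcSets ρ).filter (fun T => X.space ≤ T.inf id))
      (t := Finset.univ.filter (fun Y : A.Lattice => Y ≤ X))
      (g := fun T => if h : T ⊆ A.hyperplanes then
        (⟨OrderDual.toDual (T.inf id), T, h, rfl⟩ : A.Lattice) else Lattice.whole A)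
      (f := fun T => (-1 : ℤ) ^ T.card) (by
        intro T hT
        obtain ⟨hT, hXT⟩ := Finset.mem_filter.1 hT
        rw [dif_pos (mem_nbcSets.1 hT).1]
        exact Finset.mem_filter.2 ⟨Finset.mem_univ _, hXT⟩)
    have hinner : ∀ Y : A.Lattice, Y ≤ X →
        ((A.nbcSets ρ).filter (fun T => X.space ≤ T.inf id)).filter (fun T =>
          (if h : T ⊆ A.hyperplanes then
          (⟨OrderDual.toDual (T.inf id), T, h, rfl⟩ : A.Lattice) else Lattice.whole A) = Y) =
        (A.nbcSets ρ).filter (fun T => T.inf id = Y.space) := by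
      intro Y hY
      ext T
      simp only [Finset.mem_filter, and_assoc]
      refine and_congr_right fun hT => ?_
      rw [dif_pos (mem_nbcSets.1 hT).1]
      constructor
      · rintro ⟨-, rfl⟩
        rfl
      · intro h
        refine ⟨?_, Subtype.ext (congrArg OrderDual.toDual h)⟩
        rw [h]
        exact hY
    rw [key] at hfib
    rw [Finset.sum_congr rfl (fun Y hY => by
      rw [hinner Y (Finset.mem_filter.1 hY).2])] at hfib
    have hIic : Finset.univ.filter (fun Y : A.Lattice => Y ≤ X) =
        insert X (Finset.Ico (Lattice.whole A) X) := by
      ext Y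
      have hle : Lattice.whole A ≤ Y := show Y.space ≤ ⊤ from le_top
      simp [hle, le_iff_lt_or_eq, or_comm]
    rw [hIic, Finset.sum_insert (by simp)] at hfib
    rw [IncidenceAlgebra.mu_eq_neg_sum_Ico_of_ne hX,
      Finset.sum_congr rfl (fun Y hY => ih Y (Finset.mem_Ico.1 hY).2)]
    linarith

variable (A ρ) in
/-- The no-broken-circuit sets with `p` elements. -/
abbrev NBC (p : ℕ) : Type := {T // A.IsNBC ρ T ∧ T.card = p}

noncomputable instance (p : ℕ) : Fintype (A.NBC ρ p) :=
  Fintype.subtype ((A.nbcSets ρ).filter (fun T => T.card = p)) fun T => by simp [mem_nbcSets]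

/-- A no-broken-circuit set with `p` elements determines a flat of codimension `p`. -/
def NBC.flat (hρ : Set.InjOn ρ A.hyperplanes) {p : ℕ} (T : A.NBC ρ p) : A.LatticeCodim p :=
  ⟨⟨OrderDual.toDual (T.1.inf id), T.1, T.2.1.1, rfl⟩, by
    have := T.2.1.finrank_inf_add_card hρ
    rwa [T.2.2] at this⟩

/-- Over a flat of codimension `p` every NBC set has `p` elements, so all signs agree and cancel
against `(-1) ^ p`. -/
theorem card_nbc_eq_betti (hρ : Set.InjOn ρ A.hyperplanes) (p : ℕ) :
    (Fintype.card (A.NBC ρ p) : ℤ) = A.betti p := by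
  have hfib := Finset.sum_fiberwise (Finset.univ : Finset (A.NBC ρ p)) (NBC.flat hρ)
    (fun _ => (1 : ℤ))
  rw [Finset.sum_const, nsmul_eq_mul, mul_one, Finset.card_univ] at hfib
  rw [← hfib, betti, Finset.mul_sum]
  refine Finset.sum_congr rfl fun X _ => ?_
  rw [mu_whole_eq_sum (ρ := ρ), Finset.mul_sum]
  symm
  refine Finset.sum_bij' (fun T hT => ⟨T, (mem_nbcSets.1 (Finset.mem_filter.1 hT).1), ?_⟩)
    (fun T _ => T.1) ?_ ?_ ?_ ?_ ?_
  · have h := (mem_nbcSets.1 (Finset.mem_filter.1 hT).1).finrank_inf_add_card hρ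
    have h2 := X.2
    rw [(Finset.mem_filter.1 hT).2] at h
    omega
  · intro T hT
    refine Finset.mem_filter.2 ⟨Finset.mem_univ _, ?_⟩
    exact Subtype.ext (Subtype.ext (congrArg OrderDual.toDual (Finset.mem_filter.1 hT).2))
  · intro T hT
    refine Finset.mem_filter.2 ⟨mem_nbcSets.2 T.2.1, ?_⟩
    rw [← (Finset.mem_filter.1 hT).2]
    rfl
  · intro T hT
    rfl
  · intro T hT
    rfl
  · intro T hT
    have h := (mem_nbcSets.1 (Finset.mem_filter.1 hT).1).finrank_inf_add_card hρ
    have h2 := X.2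
    rw [(Finset.mem_filter.1 hT).2] at h
    have : T.card = p := by omega
    rw [this, ← mul_pow]
    simp

end NoBrokenCircuit

/-! ### Straightening in a commutative algebra with idempotents -/

section Straightening

variable {ι R S : Type*} [CommRing R] [CommRing S] [Algebra R S]

theorem prod_mem_span_squarefree (x : ι → S) (s a : ι → R) (B : Finset ι) :
    ∏ i ∈ B, (s i • x i + a i • (1 : S)) - (∏ i ∈ B, s i) • ∏ i ∈ B, x i ∈
      Submodule.span R ((fun U : Finset ι => ∏ i ∈ U, x i) '' {U | U ⊂ B}) := by
  have hterm : ∀ U, (∏ i ∈ U, s i • x i) * ∏ i ∈ B \ U, a i • (1 : S) =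
      ((∏ i ∈ U, s i) * ∏ i ∈ B \ U, a i) • ∏ i ∈ U, x i := by
    intro U
    simp only [Algebra.smul_def, Finset.prod_mul_distrib, mul_one, map_mul, map_prod]
    ring
  rw [Finset.prod_add, ← Finset.add_sum_erase _ _ (Finset.mem_powerset_self B), hterm]
  simp only [Finset.sdiff_self, Finset.prod_empty, mul_one, add_sub_cancel_left]
  refine Submodule.sum_mem _ fun U hU => ?_
  rw [hterm]
  refine Submodule.smul_mem _ _ (Submodule.subset_span ⟨U, ?_, rfl⟩)
  rw [Finset.mem_erase, Finset.mem_powerset] at hU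
  exact lt_of_le_of_ne hU.2 hU.1

/-- By idempotence, the monomials of `T` and `U` multiply to that of `T ∪ U`, even when they
overlap. -/
theorem mul_prod_mem_span {x : ι → S} (hx : ∀ i, x i * x i = x i) (T : Finset ι)
    {B : Set (Finset ι)} {z : S}
    (hz : z ∈ Submodule.span R ((fun U : Finset ι => ∏ i ∈ U, x i) '' B)) :
    (∏ i ∈ T, x i) * z ∈
      Submodule.span R ((fun U : Finset ι => ∏ i ∈ U, x i) '' ((fun U => T ∪ U) '' B)) := by
  have hmul : ∀ U : Finset ι, (∏ i ∈ T, x i) * ∏ i ∈ U, x i = ∏ i ∈ T ∪ U, x i := by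
    intro U
    induction U using Finset.induction_on with
    | empty => simp
    | insert a U ha ih =>
      rw [Finset.prod_insert ha, mul_left_comm, ih, Finset.union_insert]
      by_cases h : a ∈ T ∪ U
      · rw [Finset.insert_eq_of_mem h, ← Finset.mul_prod_erase _ _ h, ← mul_assoc, hx]
      · rw [Finset.prod_insert h]
  induction hz using Submodule.span_induction with
  | mem z hz =>
    obtain ⟨U, hU, rfl⟩ := hz
    exact Submodule.subset_span ⟨T ∪ U, ⟨U, hU, rfl⟩, (hmul U).symm⟩
  | zero => simp
  | add a b _ _ ha hb => rw [mul_add]; exact Submodule.add_mem _ ha hb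
  | smul r a _ ha => rw [mul_smul_comm]; exact Submodule.smul_mem _ _ ha

/-- The relation given by a circuit `insert h B`: up to lower terms the monomial of `B` is a
combination of monomials which contain `h` and miss an element of `B`. -/
theorem prod_mem_span_of_circuit {x : ι → S} (hx : ∀ i, x i * x i = x i) {B : Finset ι} {h : ι}
    (σ : ι → Prop)
    (h₁ : (1 - x h) * ∏ i ∈ B, (if σ i then x i else 1 - x i) = 0)
    (h₂ : x h * ∏ i ∈ B, (if σ i then 1 - x i else x i) = 0) :
    ∏ i ∈ B, x i ∈ Submodule.span R ((fun U : Finset ι => ∏ i ∈ U, x i) ''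
      {U | ∃ U', U' ⊂ B ∧ (U = U' ∨ U = insert h U')}) := by
  set s : ι → R := fun i => if σ i then 1 else -1
  set M := Submodule.span R ((fun U : Finset ι => ∏ i ∈ U, x i) ''
      {U | ∃ U', U' ⊂ B ∧ (U = U' ∨ U = insert h U')})
  have hs : (∏ i ∈ B, s i) * ∏ i ∈ B, s i = 1 := by
    rw [← Finset.prod_mul_distrib]
    refine Finset.prod_eq_one fun i _ => ?_
    by_cases hi : σ i <;> simp [s, hi]
  have e₁ := prod_mem_span_squarefree x s (fun i => if σ i then (0 : R) else 1) B
  have e₂ := prod_mem_span_squarefree x s (fun i => if σ i then (-1 : R) else 0) B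
  have c₁ : ∀ i, s i • x i + (if σ i then (0 : R) else 1) • (1 : S) =
      if σ i then x i else 1 - x i := by
    intro i
    by_cases hi : σ i <;> simp [s, hi]
    ring
  -- Negating each factor of the second product gives it the same leading coefficient `∏ s i` as the
  -- first.
  have c₂ : ∀ i, s i • x i + (if σ i then (-1 : R) else 0) • (1 : S) =
      -(if σ i then 1 - x i else x i) := by
    intro i
    by_cases hi : σ i <;> simp [s, hi]
    ring
  simp only [c₁] at e₁
  simp only [c₂, Finset.prod_neg] at e₂
  have hsub := Submodule.sub_mem _ e₁ e₂
  have hmul := mul_prod_mem_span hx {h} hsub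
  rw [Finset.prod_singleton] at hmul
  -- Write `P`, `Q` for the products in `h₁`, `h₂`. Then `P = x h * P` and `x h * Q = 0`, so `P = x
  -- h * (P - (-1) ^ B.card * Q)`, and the leading terms inside the bracket cancel.
  have hM₁ : ∏ i ∈ B, (if σ i then x i else 1 - x i) ∈ M := by
    have : ∏ i ∈ B, (if σ i then x i else 1 - x i) = x h *
        (∏ i ∈ B, (if σ i then x i else 1 - x i) - (∏ i ∈ B, s i) • ∏ i ∈ B, x i -
        ((-1) ^ B.card * ∏ i ∈ B, (if σ i then 1 - x i else x i) -
          (∏ i ∈ B, s i) • ∏ i ∈ B, x i)) := by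
      linear_combination h₁ + (-1) ^ B.card * h₂
    rw [this]
    refine Submodule.span_mono (Set.image_mono ?_) hmul
    rintro _ ⟨U, hU, rfl⟩
    exact ⟨U, hU, Or.inr rfl⟩
  have hM₂ : (∏ i ∈ B, s i) • ∏ i ∈ B, x i ∈ M := by
    have := Submodule.sub_mem _ hM₁ (Submodule.span_mono (Set.image_mono ?_) e₁)
    · simpa using this
    · intro U hU
      exact ⟨U, hU, Or.inl rfl⟩
  have := Submodule.smul_mem _ (∏ i ∈ B, s i) hM₂
  rwa [smul_smul, hs, one_smul] at this

end Straightening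

/-! ### Circuits of hyperplanes and spanning by NBC monomials -/

section Monomials

variable {l : ℕ} (A : HypArrangement l)

/-- The chosen equation of a hyperplane of the arrangement. -/
noncomputable def eqn (H : Submodule ℝ (Ambient l)) : Module.Dual ℝ (Ambient l) :=
  if h : H ∈ A.hyperplanes then A.form ⟨H, h⟩ else 0

variable {A} in
theorem ker_eqn {H : Submodule ℝ (Ambient l)} (hH : H ∈ A.hyperplanes) :
    LinearMap.ker (A.eqn H) = H := by
  rw [eqn, dif_pos hH, A.ker_form]

variable {A} in
theorem eqn_eq_zero_iff {H : Submodule ℝ (Ambient l)} (hH : H ∈ A.hyperplanes) {x : Ambient l} :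
    A.eqn H x = 0 ↔ x ∈ H := by
  rw [← LinearMap.mem_ker, ker_eqn hH]

variable (R : Type*) [CommRing R]

/-- The Heaviside function of a hyperplane of the arrangement. -/
noncomputable def step (H : Submodule ℝ (Ambient l)) : A.Chamber → R :=
  if h : H ∈ A.hyperplanes then A.heaviside R ⟨H, h⟩ else 0

variable {A} in
theorem step_mk {H : Submodule ℝ (Ambient l)} (hH : H ∈ A.hyperplanes) (x : A.Complement) :
    A.step R H (ConnectedComponents.mk x) = if 0 < A.eqn H x.1 then 1 else 0 := by
  rw [step, dif_pos hH, heaviside, eqn, dif_pos hH]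
  exact if_congr (A.onPositiveSide_mk ⟨H, hH⟩ x) rfl rfl

theorem step_mul_self (H : Submodule ℝ (Ambient l)) :
    A.step R H * A.step R H = A.step R H := by
  by_cases hH : H ∈ A.hyperplanes
  · ext C
    rw [step, dif_pos hH, heaviside]
    by_cases h : A.OnPositiveSide ⟨H, hH⟩ C <;> simp [heaviside, h]
  · rw [step, dif_neg hH, mul_zero]

/-- The squarefree monomial in the Heaviside functions given by a set of hyperplanes. -/
noncomputable def mono (T : Finset (Submodule ℝ (Ambient l))) : A.Chamber → R :=
  ∏ H ∈ T, A.step R H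

variable {A}

/-- A form vanishing on the common kernel of finitely many forms is a combination of them; `B` is
the support of the coefficients. -/
theorem exists_circuit {H : Submodule ℝ (Ambient l)} (hH : H ∈ A.hyperplanes)
    {T : Finset (Submodule ℝ (Ambient l))} (hT : T ⊆ A.hyperplanes) (hle : T.inf id ≤ H) :
    ∃ B ⊆ T, ∃ c : Submodule ℝ (Ambient l) → ℝ, (∀ K ∈ B, c K ≠ 0) ∧
      A.eqn H = ∑ K ∈ B, c K • A.eqn K := by
  have hmem : A.eqn H ∈ Submodule.span ℝ (Set.range fun K : T => A.eqn K.1) := by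
    refine mem_span_of_iInf_ker_le_ker ?_
    rw [ker_eqn hH]
    refine le_trans (Finset.le_inf fun K hK => ?_) hle
    exact (iInf_le _ (⟨K, hK⟩ : T)).trans (ker_eqn (hT hK)).le
  obtain ⟨c, hc⟩ := (Submodule.mem_span_range_iff_exists_fun ℝ).1 hmem
  let c' : Submodule ℝ (Ambient l) → ℝ := fun K => if h : K ∈ T then c ⟨K, h⟩ else 0
  refine ⟨T.filter (fun K => c' K ≠ 0), Finset.filter_subset _ _, c',
    fun K hK => (Finset.mem_filter.1 hK).2, ?_⟩
  rw [← hc, Finset.sum_filter, ← Finset.sum_attach T]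
  refine Finset.sum_congr rfl fun K _ => ?_
  have : c' K.1 = c K := by simp [c']
  by_cases h : c K = 0 <;> simp [this, h]

/-- If the sum `∑ c K • eqn K` is negative at a point, some term is negative there, and likewise for
positive. With `σ` the sign of `c`, this is the vanishing of the two products. -/
theorem mono_mem_span_of_circuit {H : Submodule ℝ (Ambient l)} (hH : H ∈ A.hyperplanes)
    {B : Finset (Submodule ℝ (Ambient l))} (hB : B ⊆ A.hyperplanes)
    {c : Submodule ℝ (Ambient l) → ℝ} (hc : ∀ K ∈ B, c K ≠ 0)
    (heq : A.eqn H = ∑ K ∈ B, c K • A.eqn K) :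
    A.mono R B ∈ Submodule.span R (A.mono R ''
      {U | ∃ U', U' ⊂ B ∧ (U = U' ∨ U = insert H U')}) := by
  have hval : ∀ x, A.eqn H x = ∑ K ∈ B, c K * A.eqn K x := fun x => by
    rw [heq]
    simp
  have hne : ∀ (x : A.Complement) K, K ∈ A.hyperplanes → A.eqn K x.1 ≠ 0 := fun x K hK h =>
    x.2 K hK ((eqn_eq_zero_iff hK).1 h)
  refine prod_mem_span_of_circuit (A.step_mul_self R) (fun K => 0 < c K) ?_ ?_
  · ext C
    obtain ⟨x, rfl⟩ := ConnectedComponents.surjective_coe C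
    rw [Pi.mul_apply, Finset.prod_apply, Pi.sub_apply, step_mk R hH]
    by_cases hx : 0 < A.eqn H x.1
    · simp [hx]
    · have hx' : ∑ K ∈ B, c K * A.eqn K x.1 < ∑ K ∈ B, 0 := by
        rw [← hval, Finset.sum_const_zero]
        exact lt_of_le_of_ne (not_lt.1 hx) (hne x H hH)
      obtain ⟨K, hK, hlt⟩ := Finset.exists_lt_of_sum_lt hx'
      rw [Finset.prod_eq_zero hK, mul_zero, Pi.zero_apply]
      by_cases hcK : 0 < c K
      · rw [if_pos hcK, step_mk R (hB hK), if_neg]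
        exact fun h => absurd (mul_pos hcK h) (not_lt.2 hlt.le)
      · have hcK' : c K < 0 := lt_of_le_of_ne (not_lt.1 hcK) (hc K hK)
        rw [if_neg hcK, Pi.sub_apply, step_mk R (hB hK), if_pos]
        · simp
        · by_contra h
          exact absurd (mul_nonneg_of_nonpos_of_nonpos hcK'.le (not_lt.1 h)) (not_le.2 hlt)
  · ext C
    obtain ⟨x, rfl⟩ := ConnectedComponents.surjective_coe C
    rw [Pi.mul_apply, Finset.prod_apply, step_mk R hH]
    by_cases hx : 0 < A.eqn H x.1
    · have hx' : ∑ K ∈ B, 0 < ∑ K ∈ B, c K * A.eqn K x.1 := by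
        rw [← hval, Finset.sum_const_zero]
        exact hx
      obtain ⟨K, hK, hlt⟩ := Finset.exists_lt_of_sum_lt hx'
      rw [Finset.prod_eq_zero hK, mul_zero, Pi.zero_apply]
      by_cases hcK : 0 < c K
      · rw [if_pos hcK, Pi.sub_apply, step_mk R (hB hK), if_pos]
        · simp
        · exact (pos_iff_pos_of_mul_pos hlt).1 hcK
      · rw [if_neg hcK, step_mk R (hB hK), if_neg]
        exact fun h => hcK ((pos_iff_pos_of_mul_pos hlt).2 h)
    · simp [hx]

/-- Straightening: a squarefree monomial is a combination of monomials of no-broken-circuit sets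
which are not larger. -/
theorem mono_mem_span_nbc (ρ : Submodule ℝ (Ambient l) → ℕ)
    (T : Finset (Submodule ℝ (Ambient l))) (hT : T ⊆ A.hyperplanes) :
    A.mono R T ∈ Submodule.span R (A.mono R '' {U | A.IsNBC ρ U ∧ U.card ≤ T.card}) := by
  -- The weight drops because each rewriting removes some `K` and adds at most `H`, with `ρ H < ρ
  -- K`.
  induction hw : ∑ K ∈ T, (ρ K + 1) using Nat.strong_induction_on generalizing T with
  | _ w ih =>
  by_cases hnbc : A.IsNBC ρ T
  · exact Submodule.subset_span ⟨T, ⟨hnbc, le_rfl⟩, rfl⟩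
  obtain ⟨H, hH, hle⟩ : ∃ H ∈ A.hyperplanes,
      (T.filter (fun K => ρ H < ρ K)).inf id ≤ H := by
    by_contra! hcon
    exact hnbc ⟨hT, hcon⟩
  obtain ⟨B, hBT, c, hc, heq⟩ :=
    exists_circuit hH ((Finset.filter_subset _ _).trans hT) hle
  have hB : B ⊆ T := hBT.trans (Finset.filter_subset _ _)
  have hrel := mul_prod_mem_span (A.step_mul_self R) (T \ B)
    (mono_mem_span_of_circuit R hH (hB.trans hT) hc heq)
  have hprod : (∏ K ∈ T \ B, A.step R K) * A.mono R B = A.mono R T :=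
    Finset.prod_sdiff hB
  rw [hprod] at hrel
  refine (Submodule.span_le.2 ?_) hrel
  rintro _ ⟨_, ⟨U, ⟨U', hU', hU⟩, rfl⟩, rfl⟩
  obtain ⟨K, hKB, hKU⟩ := Finset.exists_of_ssubset hU'
  have hρK : ρ H < ρ K := (Finset.mem_filter.1 (hBT hKB)).2
  have hsub : T \ B ∪ U' ⊆ T.erase K := by
    intro L hL
    rcases Finset.mem_union.1 hL with hL | hL
    · obtain ⟨h1, h2⟩ := Finset.mem_sdiff.1 hL
      exact Finset.mem_erase.2 ⟨fun h => h2 (h ▸ hKB), h1⟩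
    · exact Finset.mem_erase.2 ⟨fun h => hKU (h ▸ hL), hB (hU'.1 hL)⟩
  have hKT := hB hKB
  have hcard := Finset.card_erase_add_one hKT
  have hsum := Finset.sum_erase_add T (fun K => ρ K + 1) hKT
  have hcard' := Finset.card_le_card hsub
  have hsum' := Finset.sum_le_sum_of_subset (f := fun K => ρ K + 1) hsub
  have hlow : T \ B ∪ U ⊆ A.hyperplanes ∧ (T \ B ∪ U).card ≤ T.card ∧
      ∑ K ∈ T \ B ∪ U, (ρ K + 1) < w := by
    rcases hU with rfl | rfl
    · exact ⟨hsub.trans ((Finset.erase_subset _ _).trans hT), by omega, by omega⟩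
    · rw [Finset.union_insert]
      refine ⟨Finset.insert_subset hH (hsub.trans ((Finset.erase_subset _ _).trans hT)), ?_, ?_⟩
      · exact (Finset.card_insert_le _ _).trans (by omega)
      · by_cases hmem : H ∈ T \ B ∪ U'
        · rw [Finset.insert_eq_of_mem hmem]
          omega
        · rw [Finset.sum_insert hmem]
          omega
  refine Submodule.span_mono (Set.image_mono ?_) (ih _ hlow.2.2 _ hlow.1 rfl)
  rintro V ⟨hV, hVc⟩
  exact ⟨hV, hVc.trans hlow.2.1⟩

variable (A)

/-- The functional on `V(A)` given by a squarefree monomial in the Heaviside functions. -/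
noncomputable def monoDual (T : Finset (Submodule ℝ (Ambient l))) : Module.Dual R (A.V R) :=
  Finsupp.llift R R R A.Chamber (A.mono R T)

theorem monoDual_single (T : Finset (Submodule ℝ (Ambient l))) (C : A.Chamber) (a : R) :
    A.monoDual R T (Finsupp.single C a) = a * A.mono R T C := by
  simp [monoDual]

theorem monoDual_mem_degFil {T : Finset (Submodule ℝ (Ambient l))} (hT : T ⊆ A.hyperplanes)
    {p : ℕ} (hp : T.card ≤ p) : A.monoDual R T ∈ A.degFil R p := by
  refine ⟨∏ H : T, MvPolynomial.X ⟨H.1, hT H.2⟩, ?_, ?_⟩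
  · refine (MvPolynomial.mem_restrictTotalDegree _ _ _).2 ?_
    refine (MvPolynomial.totalDegree_finsetProd _ _).trans (le_trans ?_ hp)
    refine (Finset.sum_le_card_nsmul _ _ 1 fun H _ => ?_).trans (by simp)
    exact (MvPolynomial.totalDegree_monomial_le _ _).trans (by simp)
  · simp only [polyFunctional, LinearMap.comp_apply, AlgHom.toLinearMap_apply, map_prod,
      MvPolynomial.aeval_X, monoDual, mono]
    rw [← Finset.prod_coe_sort T]
    refine congrArg (Finsupp.llift R R R A.Chamber) ?_
    refine Finset.prod_congr rfl fun H _ => ?_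
    rw [step, dif_pos (hT H.2)]

/-- Idempotence replaces a monomial by the squarefree one on its support, without raising the
degree; straightening does the rest. -/
theorem degFil_eq_span (ρ : Submodule ℝ (Ambient l) → ℕ) (p : ℕ) :
    A.degFil R p = Submodule.span R (A.monoDual R '' {T | A.IsNBC ρ T ∧ T.card ≤ p}) := by
  apply le_antisymm
  · rintro _ ⟨q, hq, rfl⟩
    have hq := (MvPolynomial.mem_restrictTotalDegree _ _ _).1 hq
    rw [q.as_sum, map_sum]
    refine Submodule.sum_mem _ fun m hm => ?_
    have himage : A.monoDual R '' {T | A.IsNBC ρ T ∧ T.card ≤ p} =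
        (Finsupp.llift R R R A.Chamber).toLinearMap ''
          (A.mono R '' {T | A.IsNBC ρ T ∧ T.card ≤ p}) := by
      rw [Set.image_image]
      rfl
    rw [himage, ← Submodule.map_span, polyFunctional, LinearMap.comp_apply]
    refine Submodule.mem_map_of_mem ?_
    rw [AlgHom.toLinearMap_apply, MvPolynomial.aeval_monomial, ← Algebra.smul_def]
    refine Submodule.smul_mem _ _ ?_
    have hprod : (m.prod fun i k => A.heaviside R i ^ k) =
        A.mono R (m.support.map (Function.Embedding.subtype _)) := by
      rw [mono, Finset.prod_map, Finsupp.prod]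
      refine Finset.prod_congr rfl fun H hH => ?_
      have hstep : A.heaviside R H = A.step R H.1 := by rw [step, dif_pos H.2]
      have hidem : IsIdempotentElem (A.step R H.1) := A.step_mul_self R H.1
      rw [hstep]
      exact hidem.pow_eq (Finsupp.mem_support_iff.1 hH)
    rw [hprod]
    have hcard : (m.support.map (Function.Embedding.subtype
        (fun H => H ∈ A.hyperplanes))).card ≤ p := by
      rw [Finset.card_map]
      refine le_trans ?_ ((MvPolynomial.le_totalDegree hm).trans hq)
      rw [Finsupp.sum, Finset.card_eq_sum_ones]
      exact Finset.sum_le_sum fun i hi => Nat.one_le_iff_ne_zero.2 (Finsupp.mem_support_iff.1 hi)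
    refine Submodule.span_mono (Set.image_mono ?_) (mono_mem_span_nbc R ρ _ ?_)
    · rintro U ⟨hU, hUc⟩
      exact ⟨hU, hUc.trans hcard⟩
    · intro H hH
      obtain ⟨K, -, rfl⟩ := Finset.mem_map.1 hH
      exact K.2
  · refine Submodule.span_le.2 ?_
    rintro _ ⟨T, ⟨hT, hc⟩, rfl⟩
    exact A.monoDual_mem_degFil R hT.1 hc

end Monomials

/-! ### Flags, nearby chambers and dual vectors -/

section DualVectors

variable {l : ℕ} {A : HypArrangement l} {ρ : Submodule ℝ (Ambient l) → ℕ}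

variable (A) in
-- A real vector space is not a finite union of proper subspaces.
theorem exists_generic_mem (Y : Submodule ℝ (Ambient l)) :
    ∃ e ∈ Y, ∀ H ∈ A.hyperplanes, e ∈ H → Y ≤ H := by
  have h := Subspace.biUnion_ne_univ_of_top_notMem (k := ℝ) (E := Y)
    (s := (A.hyperplanes.filter (fun H => ¬ Y ≤ H)).image (fun H => H.comap Y.subtype)) (by
      intro h
      obtain ⟨H, hH, htop⟩ := Finset.mem_image.1 h
      exact (Finset.mem_filter.1 hH).2 (Submodule.comap_subtype_eq_top.1 htop))
  obtain ⟨e, he⟩ := (Set.ne_univ_iff_exists_notMem _).1 h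
  refine ⟨e.1, e.2, fun H hH heH => ?_⟩
  by_contra hY
  refine he (Set.mem_iUnion₂.2 ⟨H.comap Y.subtype, ?_, heH⟩)
  exact Finset.mem_image.2 ⟨H, Finset.mem_filter.2 ⟨hH, hY⟩, rfl⟩

/-- For small positive `t` the lowest nonzero coefficient decides the sign. The truncated `k - n` is
harmless, since `a k = 0` for `k < n`. -/
theorem eventually_sum_pow_mul_pos {a : ℕ → ℝ} {n N : ℕ} (hn : n < N)
    (h0 : ∀ k < n, a k = 0) (ha : a n ≠ 0) :
    ∀ᶠ t : ℝ in nhdsWithin 0 (Set.Ioi 0), 0 < (∑ k ∈ Finset.range N, t ^ k * a k) * a n := by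
  have hcont : Continuous (fun t : ℝ =>
      (∑ k ∈ Finset.range N, t ^ (k - n) * a k) * a n) := by fun_prop
  have hzero : (∑ k ∈ Finset.range N, (0 : ℝ) ^ (k - n) * a k) * a n = a n * a n := by
    rw [Finset.sum_eq_single_of_mem n (Finset.mem_range.2 hn)]
    · simp
    · intro k _ hk
      rcases lt_or_gt_of_ne hk with h | h
      · rw [h0 k h, mul_zero]
      · rw [zero_pow (by omega), zero_mul]
  have hev := (hcont.tendsto 0).eventually (lt_mem_nhds (show (0 : ℝ) < _ by
    rw [hzero]
    exact mul_self_pos.2 ha))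
  filter_upwards [nhdsWithin_le_nhds hev, self_mem_nhdsWithin] with t ht htpos
  have hfac : ∑ k ∈ Finset.range N, t ^ k * a k =
      t ^ n * ∑ k ∈ Finset.range N, t ^ (k - n) * a k := by
    rw [Finset.mul_sum]
    refine Finset.sum_congr rfl fun k _ => ?_
    rcases lt_or_ge k n with h | h
    · rw [h0 k h]
      simp
    · rw [← mul_assoc, ← pow_add, Nat.add_sub_cancel' h]
  rw [hfac, mul_assoc]
  exact mul_pos (pow_pos htpos n) ht

variable (ρ) in
/-- The intersection of the elements of `S` from position `n` on. -/
def upperInf (S : Finset (Submodule ℝ (Ambient l))) (n : ℕ) : Submodule ℝ (Ambient l) :=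
  (S.filter (fun K => n ≤ ρ K)).inf id

theorem upperInf_mono (S : Finset (Submodule ℝ (Ambient l))) : Monotone (upperInf ρ S) :=
  fun _ _ h => Finset.inf_mono fun _ hK =>
    Finset.mem_filter.2 ⟨(Finset.mem_filter.1 hK).1, h.trans (Finset.mem_filter.1 hK).2⟩

theorem upperInf_sup_add_one (S : Finset (Submodule ℝ (Ambient l))) :
    upperInf ρ S (S.sup ρ + 1) = ⊤ := by
  rw [upperInf, Finset.filter_false_of_mem, Finset.inf_empty]
  intro K hK
  have := Finset.le_sup (f := ρ) hK
  omega

variable (ρ) in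
/-- The position at which the flag of the `upperInf ρ S n` leaves `H`. -/
noncomputable def pivot (S : Finset (Submodule ℝ (Ambient l))) (H : Submodule ℝ (Ambient l)) : ℕ :=
  sInf {n | ¬ upperInf ρ S n ≤ H}

section pivot

variable {S : Finset (Submodule ℝ (Ambient l))} {H : Submodule ℝ (Ambient l)}

theorem not_upperInf_sup_le (hH : H ∈ A.hyperplanes) :
    ¬ upperInf ρ S (S.sup ρ + 1) ≤ H := by
  rw [upperInf_sup_add_one]
  exact fun h => (A.isCoatom H hH).1 (top_le_iff.1 h)

theorem not_upperInf_pivot_le (hH : H ∈ A.hyperplanes) : ¬ upperInf ρ S (pivot ρ S H) ≤ H :=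
  Nat.sInf_mem (s := {n | ¬ upperInf ρ S n ≤ H}) ⟨S.sup ρ + 1, not_upperInf_sup_le hH⟩

theorem pivot_le (hH : H ∈ A.hyperplanes) : pivot ρ S H ≤ S.sup ρ + 1 :=
  Nat.sInf_le (not_upperInf_sup_le hH)

theorem lt_pivot_iff (hH : H ∈ A.hyperplanes) {n : ℕ} :
    n < pivot ρ S H ↔ upperInf ρ S n ≤ H := by
  constructor
  · intro h
    by_contra hn
    exact Nat.notMem_of_lt_sInf h hn
  · intro h
    by_contra hn
    exact not_upperInf_pivot_le hH ((upperInf_mono S (not_lt.1 hn)).trans h)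

/-- `H` itself takes part in the intersection at position `ρ H`, and the NBC condition says that one
position later the flag is no longer inside `H`. -/
theorem IsNBC.pivot_eq (hS : A.IsNBC ρ S) (hH : H ∈ S) : pivot ρ S H = ρ H + 1 := by
  apply le_antisymm
  · by_contra h
    exact hS.2 H (hS.1 hH) ((lt_pivot_iff (hS.1 hH)).1 (not_le.1 h))
  · exact (lt_pivot_iff (hS.1 hH)).2 (Finset.inf_le (f := id) (Finset.mem_filter.2 ⟨hH, le_rfl⟩))

theorem IsNBC.le_of_upperInf_le (hS : A.IsNBC ρ S) (hH : H ∈ A.hyperplanes) {n : ℕ}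
    (h : upperInf ρ S n ≤ H) : n ≤ ρ H := by
  by_contra hn
  refine hS.2 H hH (le_trans (Finset.inf_mono fun K hK => ?_) h)
  have := (Finset.mem_filter.1 hK)
  exact Finset.mem_filter.2 ⟨this.1, by omega⟩

end pivot

/-- A no-broken-circuit set which is transversal to the flag of another one of the same size is
equal to it. -/
theorem IsNBC.eq_of_pivot_surjective (hρ : Set.InjOn ρ A.hyperplanes)
    {S T : Finset (Submodule ℝ (Ambient l))} (hS : A.IsNBC ρ S) (hT : A.IsNBC ρ T)
    (hcard : T.card = S.card)
    (hsub : S.image (fun K => ρ K + 1) ⊆ T.image (pivot ρ S)) : T = S := by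
  have hinjS : Set.InjOn (fun K => ρ K + 1) (S : Set (Submodule ℝ (Ambient l))) :=
    fun a ha b hb h => hρ (hS.1 ha) (hS.1 hb) (by simpa using h)
  have hcardS := Finset.card_image_of_injOn hinjS
  have hcardT := Finset.card_image_le (s := T) (f := pivot ρ S)
  have himage : S.image (fun K => ρ K + 1) = T.image (pivot ρ S) :=
    Finset.eq_of_subset_of_card_le hsub (by omega)
  have hinjT : Set.InjOn (pivot ρ S) (T : Set (Submodule ℝ (Ambient l))) := by
    rw [← Finset.card_image_iff, ← himage]
    omega
  symm
  refine Finset.eq_of_subset_of_card_le (fun K hK => ?_) hcard.le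
  -- Suppose `K ∈ S` is not in `T`. Matching pivots give `TK` and `SK` equal size, so their nested
  -- intersections have equal dimension and coincide. Hence `K` contains the intersection of `TK`,
  -- all of whose elements rank above `K`: a violation for `T`.
  set TK := T.filter (fun H => ρ K < pivot ρ S H)
  set SK := S.filter (fun H => ρ K ≤ ρ H)
  have hTK : A.IsNBC ρ TK := hT.mono (Finset.filter_subset _ _)
  have hSK : A.IsNBC ρ SK := hS.mono (Finset.filter_subset _ _)
  have hc : TK.card = SK.card := by
    rw [← Finset.card_image_of_injOn (hinjT.mono (Finset.coe_subset.2 (Finset.filter_subset _ _))),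
      ← Finset.card_image_of_injOn (hinjS.mono (Finset.coe_subset.2 (Finset.filter_subset _ _)))]
    congr 1
    have h1 : TK.image (pivot ρ S) = (T.image (pivot ρ S)).filter (fun n => ρ K < n) := by
      rw [Finset.filter_image]
    have h2 : SK.image (fun K => ρ K + 1) =
        (S.image (fun K => ρ K + 1)).filter (fun n => ρ K < n) := by
      rw [Finset.filter_image]
      simp only [Nat.lt_succ_iff, SK]
    rw [h1, h2, himage]
  have hle : SK.inf id ≤ TK.inf id := Finset.le_inf fun H hH =>
    (lt_pivot_iff (hT.1 (Finset.mem_filter.1 hH).1)).1 (Finset.mem_filter.1 hH).2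
  have heq : SK.inf id = TK.inf id := by
    refine Submodule.eq_of_le_of_finrank_eq hle ?_
    have := hTK.finrank_inf_add_card hρ
    have := hSK.finrank_inf_add_card hρ
    omega
  by_contra hKT
  refine hT.2 K (hS.1 hK) (le_trans (Finset.inf_mono (s₁ := TK) fun H hH => ?_) ?_)
  · obtain ⟨hHT, hpiv⟩ := Finset.mem_filter.1 hH
    refine Finset.mem_filter.2 ⟨hHT, lt_of_le_of_ne
      (hS.le_of_upperInf_le (hT.1 hHT) ((lt_pivot_iff (hT.1 hHT)).1 hpiv)) fun h => ?_⟩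
    exact hKT (hρ (hS.1 hK) (hT.1 hHT) h ▸ hHT)
  · rw [← heq]
    exact Finset.inf_le (f := id) (Finset.mem_filter.2 ⟨hK, le_rfl⟩)

/-- At most one `K ∈ S` has `ρ K + 1 = n`, and its equation is nonzero on a generic vector, so one
global sign change suffices. -/
theorem exists_generic_mem_upperInf (hρ : Set.InjOn ρ A.hyperplanes)
    {S : Finset (Submodule ℝ (Ambient l))} (hS : A.IsNBC ρ S) (n : ℕ) :
    ∃ e ∈ upperInf ρ S n, (∀ H ∈ A.hyperplanes, e ∈ H → upperInf ρ S n ≤ H) ∧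
      ∀ K ∈ S, ρ K + 1 = n → 0 < A.eqn K e := by
  obtain ⟨e, he, hgen⟩ := A.exists_generic_mem (upperInf ρ S n)
  by_cases h : ∃ K ∈ S, ρ K + 1 = n ∧ A.eqn K e < 0
  · obtain ⟨K, hK, hKn, hneg⟩ := h
    refine ⟨-e, Submodule.neg_mem _ he, fun H hH hmem => hgen H hH (by simpa using hmem), ?_⟩
    intro K' hK' hKn'
    have : K' = K := hρ (hS.1 hK') (hS.1 hK) (by omega)
    rw [this, map_neg]
    linarith
  · push Not at h
    refine ⟨e, he, hgen, fun K hK hKn => lt_of_le_of_ne (h K hK hKn) fun h0 => ?_⟩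
    have hmem := (eqn_eq_zero_iff (hS.1 hK)).1 h0.symm
    have := (lt_pivot_iff (hS.1 hK)).2 (hgen K (hS.1 hK) hmem)
    rw [hS.pivot_eq hK] at this
    omega

/-- Points of the complement, indexed by sign changes, near the flag of a no-broken-circuit set:
the sign of an equation is governed by its pivot. -/
theorem exists_points (hρ : Set.InjOn ρ A.hyperplanes)
    {S : Finset (Submodule ℝ (Ambient l))} (hS : A.IsNBC ρ S) (D : Finset ℕ) :
    ∃ (c : Finset ℕ → A.Complement) (s : Submodule ℝ (Ambient l) → Prop),
      (∀ U ⊆ D, ∀ H ∈ A.hyperplanes,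
        (0 < A.eqn H (c U).1 ↔ if pivot ρ S H ∈ U then ¬ s H else s H)) ∧ ∀ K ∈ S, s K := by
  choose e he hgen hpos using exists_generic_mem_upperInf hρ hS
  let ε : Finset ℕ → ℕ → ℝ := fun U k => if k ∈ U then -1 else 1
  -- The points are `∑ t ^ k • (±e k)`. The equation of `H` kills `e k` below its pivot, so for
  -- small `t` the term at the pivot fixes the sign.
  have hε : ∀ U k, ε U k ≠ 0 := fun U k => by
    by_cases h : k ∈ U <;> simp [ε, h]
  -- Pivots can be as large as `S.sup ρ + 1`, so that index must be in the range.
  let N := S.sup ρ + 2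
  let pt : ℝ → Finset ℕ → Ambient l := fun t U =>
    ∑ k ∈ Finset.range N, t ^ k • ε U k • e k
  have hpt : ∀ t U H, A.eqn H (pt t U) =
      ∑ k ∈ Finset.range N, t ^ k * (ε U k * A.eqn H (e k)) := by
    intro t U H
    simp [pt]
  have hne : ∀ H ∈ A.hyperplanes, A.eqn H (e (pivot ρ S H)) ≠ 0 := fun H hH h0 =>
    not_upperInf_pivot_le hH (hgen _ H hH ((eqn_eq_zero_iff hH).1 h0))
  have hev : ∀ᶠ t : ℝ in nhdsWithin 0 (Set.Ioi 0), ∀ U ∈ D.powerset, ∀ H ∈ A.hyperplanes,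
      0 < A.eqn H (pt t U) * (ε U (pivot ρ S H) * A.eqn H (e (pivot ρ S H))) := by
    rw [Filter.eventually_all_finset]
    intro U _
    rw [Filter.eventually_all_finset]
    intro H hH
    simp only [hpt]
    refine eventually_sum_pow_mul_pos (a := fun k => ε U k * A.eqn H (e k))
      (n := pivot ρ S H) (lt_of_le_of_lt (pivot_le hH) (Nat.lt_succ_self _))
      (fun k hk => ?_) (mul_ne_zero (hε _ _) (hne H hH))
    rw [(eqn_eq_zero_iff hH).2 ((lt_pivot_iff hH).1 hk (he k)), mul_zero]
  obtain ⟨t, ht⟩ := hev.exists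
  have hcompl : ∀ U, ∀ H ∈ A.hyperplanes, pt t (U ∩ D) ∉ H := by
    intro U H hH hmem
    have := ht (U ∩ D) (Finset.mem_powerset.2 Finset.inter_subset_right) H hH
    rw [(eqn_eq_zero_iff hH).2 hmem, zero_mul] at this
    exact lt_irrefl _ this
  -- Intersecting with `D` defines the points for every `U`, although `t` was chosen only for
  -- subsets of `D`.
  refine ⟨fun U => ⟨pt t (U ∩ D), hcompl U⟩, fun H => 0 < A.eqn H (e (pivot ρ S H)), ?_, ?_⟩
  · intro U hU H hH
    have h := ht U (Finset.mem_powerset.2 hU) H hH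
    simp only [Finset.inter_eq_left.2 hU]
    rw [pos_iff_pos_of_mul_pos h]
    by_cases hm : pivot ρ S H ∈ U
    · simp only [ε, hm, if_true, neg_mul, one_mul, Left.neg_pos_iff, not_lt]
      exact ⟨le_of_lt, fun h => lt_of_le_of_ne h (hne H hH)⟩
    · simp [ε, hm]
  · intro K hK
    rw [hS.pivot_eq hK]
    exact hpos _ K hK rfl

variable (R : Type*) [CommRing R]

theorem degFilPred_eq_span (ρ : Submodule ℝ (Ambient l) → ℕ) (p : ℕ) :
    A.degFilPred R p = Submodule.span R (A.monoDual R '' {T | A.IsNBC ρ T ∧ T.card < p}) := by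
  cases p with
  | zero => simp [degFilPred]
  | succ p =>
    simp only [degFilPred, Nat.lt_succ_iff]
    exact A.degFil_eq_span R ρ p

theorem mem_dualFil_iff (ρ : Submodule ℝ (Ambient l) → ℕ) {p : ℕ} {v : A.V R} :
    v ∈ A.dualFil R p ↔ ∀ T, A.IsNBC ρ T → T.card < p → A.monoDual R T v = 0 := by
  rw [dualFil, degFilPred_eq_span R ρ, Submodule.mem_dualCoannihilator]
  constructor
  · intro h T hT hc
    exact h _ (Submodule.subset_span ⟨T, ⟨hT, hc⟩, rfl⟩)
  · intro h f hf
    induction hf using Submodule.span_induction with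
    | mem f hf =>
      obtain ⟨T, ⟨hT, hc⟩, rfl⟩ := hf
      exact h T hT hc
    | zero => rfl
    | add f g _ _ hf hg => rw [LinearMap.add_apply, hf, hg, add_zero]
    | smul r f _ hf => rw [LinearMap.smul_apply, hf, smul_zero]

theorem sum_powerset_neg_one_pow_eq_zero {D : Finset ℕ} {d : ℕ} (hd : d ∈ D)
    (φ : Finset ℕ → R) (hφ : ∀ U ⊆ D, φ (insert d U) = φ U) :
    ∑ U ∈ D.powerset, (-1) ^ U.card * φ U = 0 := by
  rw [← Finset.insert_erase hd, Finset.sum_powerset_insert (Finset.notMem_erase d D),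
    ← Finset.sum_add_distrib]
  refine Finset.sum_eq_zero fun U hU => ?_
  have hU := Finset.mem_powerset.1 hU
  rw [hφ U (hU.trans (Finset.erase_subset _ _)),
    Finset.card_insert_of_notMem fun h => Finset.notMem_erase d D (hU h), pow_succ]
  ring

/-- The monomial of `T` sees only flips at pivots of `T`, so the alternating sum cancels unless
these cover `D`. Fewer than `|S|` elements cannot cover it, and equally many do so only for `T = S`.
In that case only the unflipped point contributes. -/
theorem exists_dual_vector (hρ : Set.InjOn ρ A.hyperplanes)
    {S : Finset (Submodule ℝ (Ambient l))} (hS : A.IsNBC ρ S) :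
    ∃ v ∈ A.dualFil R S.card, ∀ T, A.IsNBC ρ T → T.card = S.card →
      A.monoDual R T v = if T = S then 1 else 0 := by
  set D := S.image (fun K => ρ K + 1) with hD
  have hDcard : D.card = S.card := Finset.card_image_of_injOn
    fun a ha b hb h => hρ (hS.1 ha) (hS.1 hb) (by simpa using h)
  obtain ⟨c, s, hc, hs⟩ := exists_points hρ hS D
  have hstep : ∀ U ⊆ D, ∀ H ∈ A.hyperplanes, A.step R H (ConnectedComponents.mk (c U)) =
      if (if pivot ρ S H ∈ U then ¬ s H else s H) then 1 else 0 := fun U hU H hH => by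
    rw [step_mk R hH]
    exact if_congr (hc U hU H hH) rfl rfl
  set v : A.V R := ∑ U ∈ D.powerset,
    (-1 : R) ^ U.card • Finsupp.single (ConnectedComponents.mk (c U)) 1 with hv
  have hmono : ∀ T, A.monoDual R T v =
      ∑ U ∈ D.powerset, (-1) ^ U.card * A.mono R T (ConnectedComponents.mk (c U)) := by
    intro T
    simp only [hv, map_sum, map_smul, monoDual_single, smul_eq_mul, one_mul]
  have hvanish : ∀ T, A.IsNBC ρ T → ¬ D ⊆ T.image (pivot ρ S) → A.monoDual R T v = 0 := by
    intro T hT hnot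
    obtain ⟨d, hd, hdT⟩ := Finset.not_subset.1 hnot
    rw [hmono]
    refine sum_powerset_neg_one_pow_eq_zero R hd _ fun U hU => ?_
    simp only [mono, Finset.prod_apply]
    refine Finset.prod_congr rfl fun H hH => ?_
    rw [hstep _ (Finset.insert_subset hd hU) H (hT.1 hH), hstep U hU H (hT.1 hH)]
    have : pivot ρ S H ≠ d := fun h => hdT (h ▸ Finset.mem_image_of_mem _ hH)
    simp [Finset.mem_insert, this]
  refine ⟨v, (mem_dualFil_iff R ρ).2 fun T hT hlt => hvanish T hT fun hsub => ?_,
    fun T hT hcard => ?_⟩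
  · have h1 := Finset.card_le_card hsub
    have h2 := Finset.card_image_le (s := T) (f := pivot ρ S)
    omega
  · split_ifs with hTS
    · subst hTS
      rw [hmono, Finset.sum_eq_single_of_mem ∅ (Finset.empty_mem_powerset D)]
      · simp only [mono, Finset.prod_apply, Finset.card_empty, pow_zero, one_mul]
        refine Finset.prod_eq_one fun H hH => ?_
        rw [hstep _ (Finset.empty_subset _) H (hT.1 hH)]
        simp [hs H hH]
      · intro U hU hne
        obtain ⟨d, hd⟩ := Finset.nonempty_iff_ne_empty.2 hne
        have hU := Finset.mem_powerset.1 hU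
        obtain ⟨H, hH, rfl⟩ := Finset.mem_image.1 (hU hd)
        have hz : A.mono R T (ConnectedComponents.mk (c U)) = 0 := by
          rw [mono, Finset.prod_apply]
          refine Finset.prod_eq_zero hH ?_
          rw [hstep U hU H (hT.1 hH), hT.pivot_eq hH]
          simp [hd, hs H hH]
        rw [hz, mul_zero]
    · exact hvanish T hT fun hsub => hTS (hS.eq_of_pivot_surjective hρ hT hcard hsub)

end DualVectors

/-! ### NBC coordinates on the graded pieces -/

section Graded

variable {l : ℕ} {A : HypArrangement l} {ρ : Submodule ℝ (Ambient l) → ℕ}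
variable (R : Type*) [CommRing R]

variable (A ρ) in
/-- The values of the no-broken-circuit monomials of degree `p` on `W^p V`. -/
noncomputable def nbcCoords (p : ℕ) : A.dualFil R p →ₗ[R] (A.NBC ρ p → R) :=
  LinearMap.pi fun T => A.monoDual R T.1 ∘ₗ (A.dualFil R p).subtype

theorem ker_nbcCoords (p : ℕ) :
    LinearMap.ker (A.nbcCoords ρ R p) = (A.dualFil R (p + 1)).submoduleOf (A.dualFil R p) := by
  ext v
  rw [LinearMap.mem_ker, Submodule.submoduleOf, Submodule.mem_comap, mem_dualFil_iff R ρ]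
  constructor
  · intro h T hT hc
    rcases Nat.lt_succ_iff_lt_or_eq.1 hc with hlt | heq
    · exact (mem_dualFil_iff R ρ).1 v.2 T hT hlt
    · exact congrFun h ⟨T, hT, heq⟩
  · intro h
    ext T
    exact h T.1 T.2.1 (by rw [T.2.2]; exact Nat.lt_succ_self p)

theorem nbcCoords_surjective (hρ : Set.InjOn ρ A.hyperplanes) (p : ℕ) :
    Function.Surjective (A.nbcCoords ρ R p) := by
  have key : ∀ S : A.NBC ρ p, ∃ v : A.dualFil R p, A.nbcCoords ρ R p v = Pi.single S 1 := by
    rintro ⟨S, hS, rfl⟩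
    obtain ⟨v, hv, h⟩ := exists_dual_vector R hρ hS
    refine ⟨⟨v, hv⟩, ?_⟩
    ext T
    rw [Pi.single_apply]
    refine (h T.1 T.2.1 T.2.2).trans (if_congr ?_ rfl rfl)
    rw [Subtype.ext_iff]
  choose v hv using key
  intro w
  refine ⟨∑ S, w S • v S, ?_⟩
  simp only [map_sum, map_smul, hv]
  exact (pi_eq_sum_univ' w).symm

/-- The coordinates on `gr^p V` given by the no-broken-circuit monomials of degree `p`. -/
noncomputable def nbcEquiv (hρ : Set.InjOn ρ A.hyperplanes) (p : ℕ) :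
    A.GrDual R p ≃ₗ[R] (A.NBC ρ p → R) :=
  (Submodule.quotEquivOfEq _ _ (ker_nbcCoords R p).symm).trans
    (LinearMap.quotKerEquivOfSurjective _ (nbcCoords_surjective R hρ p))

/-! ### Decomposition over flats -/

section Localization

theorem injOn_localization (hρ : Set.InjOn ρ A.hyperplanes) (X : Submodule ℝ (Ambient l)) :
    Set.InjOn ρ (A.localization X).hyperplanes :=
  hρ.mono fun _ hH => ((A.mem_localization_hyperplanes).1 hH).1

theorem monoDual_natMap {S : Finset (Submodule ℝ (Ambient l))} (hS : S ⊆ A.hyperplanes)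
    {T : Finset (Submodule ℝ (Ambient l))} (hT : T ⊆ S) (v : A.V R) :
    (A.sub S hS).monoDual R T (A.natMap R S hS v) = A.monoDual R T v := by
  have h : (A.sub S hS).monoDual R T ∘ₗ A.natMap R S hS = A.monoDual R T := by
    ext C
    simp only [natMap, LinearMap.comp_apply, Finsupp.lsingle_apply, Finsupp.lmapDomain_apply,
      Finsupp.mapDomain_single, monoDual_single, mono, Finset.prod_apply, one_mul]
    refine Finset.prod_congr rfl fun H hH => ?_
    have hH' : H ∈ (A.sub S hS).hyperplanes := hT hH
    rw [step, step, dif_pos hH', dif_pos (hS (hT hH))]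
    exact A.heaviside_chamberMap R S hS ⟨H, hH'⟩ C
  exact LinearMap.congr_fun h v

/-- The inclusion of the no-broken-circuit sets of a localization. -/
def NBC.ofLocalization {X : Submodule ℝ (Ambient l)} {p : ℕ} (T : (A.localization X).NBC ρ p) :
    A.NBC ρ p :=
  ⟨T.1, (isNBC_localization_iff.1 T.2.1).1, T.2.2⟩

/-- A monomial in hyperplanes containing `X` takes the same value on a chamber and on its image, so
localization just restricts the coordinates. -/
theorem nbcEquiv_grLocalization (hρ : Set.InjOn ρ A.hyperplanes) (X : Submodule ℝ (Ambient l))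
    {p : ℕ} (a : A.GrDual R p) (T : (A.localization X).NBC ρ p) :
    nbcEquiv R (injOn_localization hρ X) p (A.grLocalization R X p a) T =
      nbcEquiv R hρ p a T.ofLocalization := by
  obtain ⟨v, rfl⟩ := Submodule.Quotient.mk_surjective _ a
  exact monoDual_natMap R (Finset.filter_subset _ _) T.2.1.1 v.1

/-- The intersection contains `X` and has the same codimension `p`. -/
theorem NBC.flat_ofLocalization (hρ : Set.InjOn ρ A.hyperplanes) {p : ℕ} {X : A.LatticeCodim p}
    (T : (A.localization X.1.space).NBC ρ p) : NBC.flat hρ T.ofLocalization = X := by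
  refine Subtype.ext (Subtype.ext (congrArg OrderDual.toDual ?_))
  symm
  refine Submodule.eq_of_le_of_finrank_eq (isNBC_localization_iff.1 T.2.1).2 ?_
  have h1 := (NBC.flat hρ T.ofLocalization).2
  have h2 := X.2
  exact Nat.add_right_cancel (h2.trans h1.symm)

/-- Each `p`-element NBC set belongs to exactly one `A_X` with `X` of codimension `p`, so the
coordinates of the summands partition those of `gr^p V(A)`. -/
theorem bijective_pi_grLocalization (hρ : Set.InjOn ρ A.hyperplanes) (p : ℕ) :
    Function.Bijective (LinearMap.pi (fun X : A.LatticeCodim p =>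
      A.grLocalization R X.1.space p)) := by
  have hmem : ∀ T : A.NBC ρ p,
      (A.localization (NBC.flat hρ T).1.space).IsNBC ρ T.1 ∧ T.1.card = p := fun T =>
    ⟨isNBC_localization_iff.2 ⟨T.2.1, le_rfl⟩, T.2.2⟩
  constructor
  · rw [← LinearMap.ker_eq_bot, LinearMap.ker_eq_bot']
    intro a ha
    rw [← (nbcEquiv R hρ p).map_eq_zero_iff]
    ext T
    have h := nbcEquiv_grLocalization R hρ (NBC.flat hρ T).1.space a ⟨T.1, hmem T⟩
    have h0 : A.grLocalization R (NBC.flat hρ T).1.space p a = 0 := congrFun ha (NBC.flat hρ T)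
    rw [h0, map_zero] at h
    exact h.symm
  · intro b
    let w : A.NBC ρ p → R := fun T =>
      nbcEquiv R (injOn_localization hρ _) p (b (NBC.flat hρ T)) ⟨T.1, hmem T⟩
    refine ⟨(nbcEquiv R hρ p).symm w, ?_⟩
    ext X
    apply (nbcEquiv R (injOn_localization hρ X.1.space) p).injective
    ext T
    rw [LinearMap.pi_apply, nbcEquiv_grLocalization R hρ, LinearEquiv.apply_symm_apply]
    -- The type of `b X` depends on `X`; a variable `X` lets the equality of flats be substituted
    -- away.
    have key : ∀ (T : A.NBC ρ p) (X : A.LatticeCodim p) (_ : NBC.flat hρ T = X)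
        (hT : (A.localization X.1.space).IsNBC ρ T.1 ∧ T.1.card = p),
        w T = nbcEquiv R (injOn_localization hρ _) p (b X) ⟨T.1, hT⟩ := by
      rintro T _ rfl hT
      rfl
    exact key T.ofLocalization X (NBC.flat_ofLocalization hρ T) T.2

end Localization

/-! ### The perfect pairing -/

section Pairing

variable (A) in
/-- The pairing of `P_p V*` with `gr^p V`. -/
noncomputable def degFilPairing (p : ℕ) : A.degFil R p →ₗ[R] Module.Dual R (A.GrDual R p) where
  toFun f := Submodule.liftQ _ (f.1 ∘ₗ (A.dualFil R p).subtype) fun v hv =>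
    (Submodule.mem_dualCoannihilator v.1).1 (show v.1 ∈ A.dualFil R (p + 1) from hv) f.1 f.2
  map_add' f g := by
    ext v
    rfl
  map_smul' r f := by
    ext v
    rfl

theorem exists_eq_add_sum_monoDual (ρ : Submodule ℝ (Ambient l) → ℕ) {p : ℕ}
    {f : Module.Dual R (A.V R)} (hf : f ∈ A.degFil R p) :
    ∃ g ∈ A.degFilPred R p, ∃ a : A.NBC ρ p → R, f = g + ∑ T, a T • A.monoDual R T.1 := by
  have hsub : A.monoDual R '' {T | A.IsNBC ρ T ∧ T.card ≤ p} ⊆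
      A.monoDual R '' {T | A.IsNBC ρ T ∧ T.card < p} ∪
        Set.range (fun T : A.NBC ρ p => A.monoDual R T.1) := by
    rintro _ ⟨T, ⟨hT, hc⟩, rfl⟩
    rcases lt_or_eq_of_le hc with h | h
    · exact Or.inl ⟨T, ⟨hT, h⟩, rfl⟩
    · exact Or.inr ⟨⟨T, hT, h⟩, rfl⟩
  rw [A.degFil_eq_span R ρ] at hf
  have hf := Submodule.span_mono hsub hf
  rw [Submodule.span_union, Submodule.mem_sup] at hf
  obtain ⟨g, hg, h, hh, rfl⟩ := hf
  obtain ⟨a, rfl⟩ := (Submodule.mem_span_range_iff_exists_fun R).1 hh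
  exact ⟨g, by rwa [degFilPred_eq_span R ρ], a, rfl⟩

/-- Modulo `P_{p-1} V*`, an element is a combination of degree `p` NBC monomials, and evaluation on
the dual vectors recovers each coefficient. -/
theorem ker_degFilPairing (hρ : Set.InjOn ρ A.hyperplanes) (p : ℕ) :
    LinearMap.ker (A.degFilPairing R p) = (A.degFilPred R p).submoduleOf (A.degFil R p) := by
  ext f
  change A.degFilPairing R p f = 0 ↔ f.1 ∈ A.degFilPred R p
  constructor
  · intro h
    obtain ⟨g, hg, a, hfa⟩ := exists_eq_add_sum_monoDual R ρ f.2
    have ha : ∀ S, a S = 0 := by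
      intro S
      obtain ⟨v, hv⟩ := nbcCoords_surjective R hρ p (Pi.single S 1)
      have hcoord : ∀ T : A.NBC ρ p, A.monoDual R T.1 v.1 = (Pi.single S 1 : A.NBC ρ p → R) T :=
        fun T => congrFun hv T
      have hfv : f.1 v.1 = 0 := LinearMap.congr_fun h (Submodule.Quotient.mk v)
      have hgv : g v.1 = 0 := (Submodule.mem_dualCoannihilator v.1).1 v.2 g hg
      rw [hfa, LinearMap.add_apply, hgv, zero_add, LinearMap.sum_apply] at hfv
      simpa [hcoord, Pi.single_apply] using hfv
    simp only [ha, zero_smul, Finset.sum_const_zero, add_zero] at hfa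
    rwa [hfa]
  · intro h
    ext v
    exact (Submodule.mem_dualCoannihilator v.1).1 v.2 f.1 h

/-- The degree `p` NBC monomials pair as the coordinate functionals of `gr^p V`, and these span its
dual. -/
theorem degFilPairing_surjective (hρ : Set.InjOn ρ A.hyperplanes) (p : ℕ) :
    Function.Surjective (A.degFilPairing R p) := by
  intro φ
  let e := nbcEquiv R hρ p
  let b : A.NBC ρ p → A.degFil R p := fun T =>
    ⟨A.monoDual R T.1, A.monoDual_mem_degFil R T.2.1.1 T.2.2.le⟩
  have hb : ∀ T a, A.degFilPairing R p (b T) a = e a T := by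
    intro T a
    obtain ⟨v, rfl⟩ := Submodule.Quotient.mk_surjective _ a
    rfl
  refine ⟨∑ T, φ (e.symm (Pi.single T 1)) • b T, ?_⟩
  refine LinearMap.ext fun a => ?_
  rw [map_sum, LinearMap.sum_apply]
  simp only [map_smul, LinearMap.smul_apply, hb]
  conv_rhs => rw [← e.symm_apply_apply a, pi_eq_sum_univ' (e a)]
  simp only [map_sum, map_smul, smul_eq_mul]
  exact Finset.sum_congr rfl fun T _ => mul_comm _ _

end Pairing

end Graded

end HypArrangement

theorem mainTheorem8 (R : Type*) [CommRing R] [Nontrivial R] (l : ℕ) (A : HypArrangement l)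
    (hA : A.IsEssential) (p : ℕ) (hp : p ≤ l) :
    (∃ Φ : A.GrDeg R p ≃ₗ[R] Module.Dual R (A.GrDual R p),
      ∀ (f : A.degFil R p) (v : A.dualFil R p),
        Φ (Submodule.Quotient.mk f) (Submodule.Quotient.mk v) = f.1 v.1) ∧
    (Module.Free R (A.GrDual R p) ∧ Module.Finite R (A.GrDual R p) ∧
      (Module.finrank R (A.GrDual R p) : ℤ) = A.betti p) ∧
    (∃ Ψ : A.GrDual R p ≃ₗ[R]
        DirectSum (A.LatticeCodim p) (fun X => (A.localization X.1.space).GrDual R p),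
      ∀ (v : A.GrDual R p) (X : A.LatticeCodim p),
        Ψ v X = A.grLocalization R X.1.space p v) := by
  -- Any injective ranking will do; the isomorphisms and the Betti number do not refer to it.
  obtain ⟨ρ, hρ⟩ := Set.countable_iff_exists_injOn.1 A.hyperplanes.countable_toSet
  have e := HypArrangement.nbcEquiv R hρ p
  refine ⟨⟨(Submodule.quotEquivOfEq _ _ (HypArrangement.ker_degFilPairing R hρ p).symm).trans
    (LinearMap.quotKerEquivOfSurjective _ (HypArrangement.degFilPairing_surjective R hρ p)),
    fun f v => rfl⟩, ⟨Module.Free.of_equiv e.symm, Module.Finite.equiv e.symm, ?_⟩,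
    ⟨(LinearEquiv.ofBijective _ (HypArrangement.bijective_pi_grLocalization R hρ p)).trans
      (DirectSum.linearEquivFunOnFintype R _ _).symm, fun v X => ?_⟩⟩
  · rw [e.finrank_eq, Module.finrank_fintype_fun_eq_card]
    exact HypArrangement.card_nbc_eq_betti hρ p
  · exact congrFun ((DirectSum.linearEquivFunOnFintype R (A.LatticeCodim p)
      (fun X => (A.localization X.1.space).GrDual R p)).apply_symm_apply _) X
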